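/- Let $n\ge 2$, $p\ge 0$. Let $\Omega_1,\Omega_2\subset\mathbb R^n$ be disjoint polyhedral open sets, each the interior of the union of the simplices of a finite conforming simplicial mesh $\mathcal T_i$, and let $\Gamma=\partial\Omega_1\cap\partial\Omega_2$. The two meshes need not match on $\Gamma$, but up to a set of zero surface measure $\Gamma$ is the union of the edges/faces $E$ of elements of $\mathcal T_1$ with $E\subset\Gamma$. Let $h_E=\operatorname{diam}E$, let $n_1$ be the outward unit normal of $\Omega_1$ on $\Gamma$, and let $V_h=V_{1,h}\times V_{2,h}$, where $V_{i,h}$ is the space of continuous functions on $\overline\Omega_i$ that are polynomials of degree at most $p$ on each element of $\mathcal T_i$ (no boundary condition is required). $\mathcal T_1$ is called shape regular with parameter $\sigma$ if every $K\in\mathcal T_1$ contains a ball of some radius $r>0$ with $\operatorname{diam}K\le\sigma r$. For a function $\varepsilon$ on $\Gamma$ define the one-sided (master–slave) Nitsche form $$\mathcal B(u,v)=\sum_{i=1}^2\Big(\int_{\Omega_i}\nabla u_i\cdot\nabla v_i\,dx+\int_\Gamma\frac1\varepsilon(u_i-u_j)v_i\,ds\Big)-\int_\Gamma\frac{\partial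 u_1}{\partial n_1}(v_1-v_2)\,ds-\int_\Gamma\frac{\partial v_1}{\partial n_1}(u_1-u_2)\,ds,\qquad j\ne i .$$ For a constant $C_I>0$ consider the discrete inverse trace inequality $$\sum_{E\subset\partial K\cap\Gamma}h_E\int_E\Big|\frac{\partial v_1}{\partial n_1}\Big|^2ds\le C_I\int_K|\nabla v_1|^2dx\qquad\text{for all }K\in\mathcal T_1,\ v_1\in V_{1,h},\tag{1}$$ (the sum runs over the faces $E$ of $K$ that lie on $\Gamma$), and for $c>0$ the stability estimate $$\mathcal B(v,v)\ge c\,\Big(\sum_{i=1}^2\int_{\Omega_i}|\nabla v_i|^2dx+\sum_{E\subset\Gamma}\int_E\frac1{h_E}(v_1-v_2)^2ds\Big)\qquad\text{for all }v=(v_1,v_2)\in V_h.\tag{2}$$ (a) For every $\sigma$ there is a constant $C_I>0$, depending only on $n$, $p$ and $\sigma$, such that (1) holds whenever $\mathcal T_1$ is shape regular with parameter $\sigma$, and such that for every $\gamma>C_I$ there is $c>0$ for which (2) holds on all such meshes if $\varepsilon|_E=h_E/(2\gamma)$ on every edge/face $E\subset\Gamma$. (b) More precisely, for all $\gamma>C_I>0$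 there is $c>0$, depending only on $C_I$, $\gamma$, $n$ and $p$, such that (2) holds on every mesh on which (1) holds with the constant $C_I$, if $\varepsilon|_E=h_E/(2\gamma)$ on every edge/face $E\subset\Gamma$. -/

import Mathlib

open MeasureTheory

namespace Nitsche

/-- Euclidean space `ℝⁿ`. -/
abbrev Pt (n : ℕ) : Type := EuclideanSpace ℝ (Fin n)

/-- The closed simplex spanned by a finite set of vertices. -/
def hull {n : ℕ} (s : Finset (Pt n)) : Set (Pt n) := convexHull ℝ (s : Set (Pt n))

/-- `ν` is the outward unit normal of the open set `Ω` at the boundary point `x`: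
near `x`, the set `Ω` is the open half-space of points `y` with `⟪y - x, ν⟫ < 0`.
For a polyhedral domain this covers all boundary points outside a set of dimension `n - 2`. -/
def IsOutwardNormal {n : ℕ} (Ω : Set (Pt n)) (x ν : Pt n) : Prop :=
  ‖ν‖ = 1 ∧ ∀ᶠ y in nhds x, (y ∈ Ω ↔ inner ℝ (y - x) ν < 0)

/-- The outward unit normal at a point is unique. -/
theorem IsOutwardNormal.unique {n : ℕ} {Ω : Set (Pt n)} {x ν μ : Pt n}
    (hν : IsOutwardNormal Ω x ν) (hμ : IsOutwardNormal Ω x μ) : ν = μ := by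
  by_contra hne
  have hlt : inner ℝ μ ν < (1 : ℝ) := by
    refine lt_of_le_of_ne ?_ ?_
    · simpa [hν.1, hμ.1] using real_inner_le_norm μ ν
    · intro h
      exact hne ((inner_eq_one_iff_of_norm_eq_one hμ.1 hν.1).1 h).symm
  have ht : Filter.Tendsto (fun t : ℝ => x + t • (μ - ν)) (nhdsWithin 0 (Set.Ioi 0)) (nhds x) := by
    have hc : Continuous (fun t : ℝ => x + t • (μ - ν)) := by fun_prop
    have := (hc.tendsto 0).mono_left (nhdsWithin_le_nhds (s := Set.Ioi (0 : ℝ)))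
    simpa using this
  have hev := (ht.eventually (hν.2.and hμ.2)).and
    (self_mem_nhdsWithin : Set.Ioi (0 : ℝ) ∈ nhdsWithin 0 (Set.Ioi 0))
  obtain ⟨t, ⟨h1, h2⟩, ht0⟩ := hev.exists
  have ht0 : 0 < t := ht0
  have e1 : inner ℝ (x + t • (μ - ν) - x) ν = t * (inner ℝ μ ν - 1) := by
    rw [add_sub_cancel_left, real_inner_smul_left, inner_sub_left,
      real_inner_self_eq_norm_sq, hν.1]
    norm_num
  have e2 : inner ℝ (x + t • (μ - ν) - x) μ = t * (1 - inner ℝ μ ν) := by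
    rw [add_sub_cancel_left, real_inner_smul_left, inner_sub_left,
      real_inner_self_eq_norm_sq, hμ.1, real_inner_comm]
    norm_num
  have h3 := h2.1 (h1.2 (by rw [e1]; nlinarith))
  rw [e2] at h3
  nlinarith

open Classical in
/-- The outward unit normal of `Ω` at `x` (zero where there is none). -/
noncomputable def outwardNormal {n : ℕ} (Ω : Set (Pt n)) (x : Pt n) : Pt n :=
  if h : ∃ ν, IsOutwardNormal Ω x ν then h.choose else 0

/-- The normal derivative `∂v/∂n` at a boundary point of `Ω`, taken from inside of `Ω`. -/
noncomputable def normalDeriv {n : ℕ} (Ω : Set (Pt n)) (v : Pt n → ℝ) (x : Pt n) : ℝ :=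
  inner ℝ (gradientWithin v (closure Ω) x) (outwardNormal Ω x)

/-- Two disjoint polyhedral subdomains of `ℝⁿ`, each with a finite simplicial mesh, such that the
common boundary is resolved by the mesh of the first subdomain (index `0`, the slave side).
The two meshes need not match along the common boundary. -/
structure InterfaceMesh (n : ℕ) where
  /-- the simplicial complexes of the two meshes -/
  T : Fin 2 → Geometry.SimplicialComplex ℝ (Pt n)
  finite : ∀ i, (T i).faces.Finite
  /-- every simplex of the complex is a face of an `n`-dimensional one -/
  pure : ∀ i, ∀ t ∈ (T i).faces, ∃ s ∈ (T i).faces, s.card = n + 1 ∧ t ⊆ s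
  /-- the two subdomains do not overlap -/
  disjoint : Disjoint (interior (T 0).space) (interior (T 1).space)
  /-- up to a set of zero surface measure, the common boundary is made of mesh faces of the
  first mesh -/
  resolved :
    μHE[n - 1] {x ∈ frontier (interior (T 0).space) ∩ frontier (interior (T 1).space) |
      ∀ t ∈ (T 0).faces, t.card = n →
        hull t ⊆ frontier (interior (T 0).space) ∩ frontier (interior (T 1).space) →
        x ∉ hull t} = 0

namespace InterfaceMesh

variable {n : ℕ} (M : InterfaceMesh n)

/-- The (open) subdomains `Ω₁` (index `0`) and `Ω₂` (index `1`). -/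
def Ω (i : Fin 2) : Set (Pt n) := interior (M.T i).space

/-- The interface `Γ = ∂Ω₁ ∩ ∂Ω₂`. -/
def Γ : Set (Pt n) := frontier (M.Ω 0) ∩ frontier (M.Ω 1)

open Classical in
/-- The elements (`n`-dimensional simplices) of the mesh of the `i`-th subdomain. -/
noncomputable def cells (i : Fin 2) : Finset (Finset (Pt n)) :=
  {s ∈ (M.finite i).toFinset | s.card = n + 1}

open Classical in
/-- The edges/faces (simplices of dimension `n - 1`) of the first mesh that lie on `Γ`. -/
noncomputable def interfaceFaces : Finset (Finset (Pt n)) :=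
  {t ∈ (M.finite 0).toFinset | t.card = n ∧ hull t ⊆ M.Γ}

/-- Piecewise polynomials of degree at most `p` on the `i`-th mesh: functions that coincide with a
polynomial on every closed element; as they are single-valued on the common faces of the elements,
they are continuous on the closure of the subdomain. Only the values there matter.
No boundary condition is imposed, so that the functions vanishing on `∂Ωᵢ ∖ Γ` are included. -/
def space (p : ℕ) (i : Fin 2) : Set (Pt n → ℝ) :=
  {v | ∀ s ∈ M.cells i, ∃ q : MvPolynomial (Fin n) ℝ, q.totalDegree ≤ p ∧
    ∀ x ∈ hull s, v x = MvPolynomial.eval (fun j => x j) q}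

/-- Shape regularity of the mesh of the first subdomain with parameter `σ`: every element contains
a ball whose radius is at least the diameter of the element divided by `σ`. -/
def ShapeRegular (σ : ℝ) : Prop :=
  ∀ s ∈ M.cells 0, ∃ (x : Pt n) (r : ℝ), 0 < r ∧ Metric.closedBall x r ⊆ hull s ∧
    Metric.diam (hull s) ≤ σ * r

/-- The local mesh length `h_E`: the diameter of the edge/face `E`. -/
noncomputable def hE (t : Finset (Pt n)) : ℝ := Metric.diam (hull t)

/-- The discrete inverse trace inequality with constant `C` on the first mesh:
`∑_{E ⊂ ∂K ∩ Γ} h_E ∫_E |∂v₁/∂n₁|² ds ≤ C ∫_K |∇v₁|² dx` for every element `K` and every piecewise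
polynomial `v₁`. The sum has one term when only one face of `K` lies on `Γ`. -/
def InverseTrace (p : ℕ) (C : ℝ) : Prop :=
  ∀ v ∈ M.space p 0, ∀ s ∈ M.cells 0,
    ∑ t ∈ M.interfaceFaces with t ⊆ s,
        hE t * ∫ x in hull t, |normalDeriv (M.Ω 0) v x| ^ 2 ∂μHE[n - 1]
      ≤ C * ∫ x in hull s, ‖gradient v x‖ ^ 2

/-- Nitsche's (one-sided, master-slave) bilinear form with the first subdomain as the slave:
`B(u,v) = ∑ᵢ (∫_{Ωᵢ} ∇uᵢ·∇vᵢ dx + ∫_Γ ε⁻¹ (uᵢ - uⱼ) vᵢ ds)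
  - ∫_Γ ∂u₁/∂n₁ (v₁ - v₂) ds - ∫_Γ ∂v₁/∂n₁ (u₁ - u₂) ds`, where `j ≠ i`. -/
noncomputable def B (ε : Pt n → ℝ) (u v : Fin 2 → Pt n → ℝ) : ℝ :=
  ∑ i : Fin 2, ((∫ x in M.Ω i, inner ℝ (gradient (u i) x) (gradient (v i) x))
      + ∫ x in M.Γ, 1 / ε x * (u i x - u i.rev x) * v i x ∂μHE[n - 1])
    - (∫ x in M.Γ, normalDeriv (M.Ω 0) (u 0) x * (v 0 x - v 1 x) ∂μHE[n - 1])
    - ∫ x in M.Γ, normalDeriv (M.Ω 0) (v 0) x * (u 0 x - u 1 x) ∂μHE[n - 1]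

/-- The squared mesh-dependent energy norm
`∑ᵢ ∫_{Ωᵢ} |∇vᵢ|² dx + ∑_{E ⊂ Γ} ∫_E h_E⁻¹ (v₁ - v₂)² ds`. -/
noncomputable def energy (v : Fin 2 → Pt n → ℝ) : ℝ :=
  ∑ i : Fin 2, (∫ x in M.Ω i, ‖gradient (v i) x‖ ^ 2)
    + ∑ t ∈ M.interfaceFaces, ∫ x in hull t, 1 / hE t * (v 0 x - v 1 x) ^ 2 ∂μHE[n - 1]

/-- `ε|_E = h_E / (2γ)` on every edge/face `E ⊂ Γ` (almost everywhere, since different faces may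
share lower-dimensional simplices). -/
def IsNitscheParameter (γ : ℝ) (ε : Pt n → ℝ) : Prop :=
  ∀ t ∈ M.interfaceFaces, ∀ᵐ x ∂((μHE[n - 1]).restrict (hull t)), ε x = hE t / (2 * γ)

end InterfaceMesh

end Nitsche

namespace Nitsche

/-! Coercivity is an absorption argument. In `B v v` the two penalty terms add up to `2γ` times the
jump energy `J`, and the two consistency terms coincide. Young's inequality with weight `γ` on each
face bounds them by `γ J` plus `1/γ` times the sum of `h_E ∫_E |∂v₁/∂n₁|²`, and the inverse trace
inequality bounds the latter by `C/γ` times the Dirichlet energy on the slave side. What is left has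
the constant `min (1 - C/γ) γ` (`energy_le_B`). The master mesh enters only through the continuity
and integrability of its functions, so the meshes need not match.

For shape regular meshes the inverse trace inequality is proved with an explicit cone instead of a
reference element. Each point of a facet is joined to the centre of a ball inside the element; along
half of that segment every partial derivative is a univariate polynomial of degree at most `p`, and
its endpoint value is bounded by its mean square (`exists_sq_eval_zero_le_integral`). Integrating
over the facet and comparing product measure with volume (`map_cone_le`) gives the trace bound
(`simplex_trace_le`); the height of the cone is at least the radius of the ball, which shape
regularity relates to `h_E`.

The remaining work is geometric: almost everywhere on an interface face only one element is present
(`notMem_hull_of_ne`), so the normal is constant there and the one-sided gradient is that of one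
polynomial. -/

/-! ### Endpoint estimate for univariate polynomials -/

/-- This is the vanishing of the forward difference of order `p + 1` at `0` of the rescaled
polynomial. -/
theorem sum_choose_eval_eq_zero (G : Polynomial ℝ) {p : ℕ} (hG : G.natDegree ≤ p) (τ : ℝ) :
    ∑ k ∈ Finset.range (p + 2),
      ((-1 : ℝ) ^ (p + 1 - k) * (p + 1).choose k) * G.eval (k * τ) = 0 := by
  have hd : (G.comp (Polynomial.C τ * Polynomial.X)).natDegree < p + 1 := by
    refine lt_of_le_of_lt Polynomial.natDegree_comp_le ?_
    have : (Polynomial.C τ * Polynomial.X : Polynomial ℝ).natDegree ≤ 1 :=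
      (Polynomial.natDegree_C_mul_le _ _).trans Polynomial.natDegree_X_le
    nlinarith
  have h := congrFun (Polynomial.fwdDiff_iter_eq_zero_of_degree_lt hd) 0
  rw [fwdDiff_iter_eq_sum_shift] at h
  simpa [mul_comm τ] using h

/-- In the vanishing difference the value at `0` has coefficient `±1`; solving for it and applying
Cauchy–Schwarz gives the bound by samples away from `0`. -/
theorem sq_eval_zero_le_sum (G : Polynomial ℝ) {p : ℕ} (hG : G.natDegree ≤ p) (τ : ℝ) :
    G.eval 0 ^ 2 ≤ (∑ k ∈ Finset.range (p + 1), ((p + 1).choose (k + 1) : ℝ) ^ 2) *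
      ∑ k ∈ Finset.range (p + 1), G.eval ((k + 1) * τ) ^ 2 := by
  have h := sum_choose_eval_eq_zero G hG τ
  rw [Finset.sum_range_succ'] at h
  have h2 := Finset.sum_mul_sq_le_sq_mul_sq (Finset.range (p + 1))
    (fun k => (-1 : ℝ) ^ (p + 1 - (k + 1)) * (p + 1).choose (k + 1))
    (fun k => G.eval ((k + 1) * τ))
  have e : ∀ k : ℕ, ((-1 : ℝ) ^ k) ^ 2 = 1 := fun k => by rw [← pow_mul, mul_comm, pow_mul]; simp
  simp only [mul_pow, e, one_mul] at h2
  refine le_trans (le_of_eq ?_) h2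
  have h3 := eq_neg_of_add_eq_zero_left h
  push_cast at h3
  have h4 : ∀ k, p + 1 - (k + 1) = p - k := fun k => by omega
  simp only [h4] at h3 ⊢
  rw [show (∑ k ∈ Finset.range (p + 1), _) = _ from h3]
  simp [mul_pow, e]

/-- The value of a polynomial of bounded degree at an endpoint of an interval is controlled by
its mean square over the interval. -/
theorem exists_sq_eval_zero_le_integral (p : ℕ) : ∃ C : ℝ, 0 < C ∧
    ∀ G : Polynomial ℝ, G.natDegree ≤ p →
      G.eval 0 ^ 2 ≤ C * ∫ s in (0 : ℝ)..(1 / 2), G.eval s ^ 2 := by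
  set A : ℝ := ∑ k ∈ Finset.range (p + 1), ((p + 1).choose (k + 1) : ℝ) ^ 2 with hA
  have hA0 : 0 < A := Finset.sum_pos (fun k hk => by
    have : 0 < (p + 1).choose (k + 1) := Nat.choose_pos (by simpa using hk)
    positivity) (by simp)
  -- With this step bound, all samples `(k + 1) τ` with `τ ≤ δ` and `k ≤ p` stay in `[0, 1/2]`, so
  -- the sample inequality can be averaged over `τ`.
  set δ : ℝ := 1 / (2 * (p + 1)) with hδ
  have hδ0 : 0 < δ := by positivity
  refine ⟨A * (p + 1) / δ, by positivity, fun G hG => ?_⟩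
  set I : ℝ := ∫ s in (0 : ℝ)..(1 / 2), G.eval s ^ 2
  have hc : Continuous fun s => G.eval s ^ 2 := by fun_prop
  have hterm : ∀ k ∈ Finset.range (p + 1),
      ∫ τ in (0 : ℝ)..δ, G.eval (((k : ℝ) + 1) * τ) ^ 2 ≤ I := by
    intro k hk
    have hk' : (k : ℝ) + 1 ≤ p + 1 := by
      have := Finset.mem_range.1 hk
      exact_mod_cast this
    have hk0 : (1 : ℝ) ≤ k + 1 := by linarith [(Nat.cast_nonneg k : (0 : ℝ) ≤ k)]
    rw [intervalIntegral.integral_comp_mul_left (fun s => G.eval s ^ 2) (by positivity), mul_zero,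
      smul_eq_mul]
    have hle : ∫ s in (0 : ℝ)..((k + 1) * δ), G.eval s ^ 2 ≤ I := by
      refine intervalIntegral.integral_mono_interval le_rfl (by positivity) ?_
        (Filter.Eventually.of_forall fun s => by positivity) (hc.intervalIntegrable _ _)
      calc ((k : ℝ) + 1) * δ ≤ (p + 1) * δ := by gcongr
        _ = 1 / 2 := by rw [hδ]; field_simp
    have h0 : 0 ≤ ∫ s in (0 : ℝ)..((k + 1) * δ), G.eval s ^ 2 :=
      intervalIntegral.integral_nonneg (by positivity) fun s _ => by positivity
    calc ((k : ℝ) + 1)⁻¹ * ∫ s in (0 : ℝ)..((k + 1) * δ), G.eval s ^ 2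
        ≤ 1 * ∫ s in (0 : ℝ)..((k + 1) * δ), G.eval s ^ 2 := by
          gcongr
          exact inv_le_one_of_one_le₀ hk0
      _ ≤ I := by rw [one_mul]; exact hle
  have hint : δ * G.eval 0 ^ 2 ≤ A * ∑ k ∈ Finset.range (p + 1),
      ∫ τ in (0 : ℝ)..δ, G.eval (((k : ℝ) + 1) * τ) ^ 2 := by
    rw [← intervalIntegral.integral_finsetSum
      fun k _ => (by fun_prop : Continuous _).intervalIntegrable _ _,
      ← intervalIntegral.integral_const_mul]
    have := intervalIntegral.integral_mono_on (μ := volume) (a := 0) (b := δ)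
      (f := fun _ => G.eval 0 ^ 2) hδ0.le (by simp)
      ((by fun_prop : Continuous fun τ => A * ∑ k ∈ Finset.range (p + 1),
        G.eval (((k : ℝ) + 1) * τ) ^ 2).intervalIntegrable 0 δ)
      (fun τ _ => sq_eval_zero_le_sum G hG τ)
    simpa using this
  have hsum := Finset.sum_le_sum hterm
  simp only [Finset.sum_const, Finset.card_range, nsmul_eq_mul] at hsum
  push_cast at hsum
  rw [div_mul_eq_mul_div, le_div_iff₀ hδ0]
  nlinarith [mul_le_mul_of_nonneg_left hsum hA0.le]

/-! ### Multivariate polynomials and their gradients -/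

/-- A multivariate polynomial, as a function on Euclidean space. -/
noncomputable def evalFun {n : ℕ} (q : MvPolynomial (Fin n) ℝ) (x : Pt n) : ℝ :=
  MvPolynomial.eval (fun j => x j) q

/-- The gradient of a multivariate polynomial. -/
noncomputable def gradFun {n : ℕ} (q : MvPolynomial (Fin n) ℝ) (x : Pt n) : Pt n :=
  WithLp.toLp 2 fun j => evalFun (MvPolynomial.pderiv j q) x

theorem continuous_evalFun {n : ℕ} (q : MvPolynomial (Fin n) ℝ) : Continuous (evalFun q) :=
  (MvPolynomial.continuous_eval q).comp (by fun_prop)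

theorem continuous_gradFun {n : ℕ} (q : MvPolynomial (Fin n) ℝ) : Continuous (gradFun q) :=
  (PiLp.continuous_toLp 2 _).comp (continuous_pi fun _ => continuous_evalFun _)

theorem norm_sq_gradFun {n : ℕ} (q : MvPolynomial (Fin n) ℝ) (x : Pt n) :
    ‖gradFun q x‖ ^ 2 = ∑ j, evalFun (MvPolynomial.pderiv j q) x ^ 2 := by
  simp [EuclideanSpace.norm_sq_eq, gradFun]

theorem hasGradientAt_evalFun {n : ℕ} (q : MvPolynomial (Fin n) ℝ) (x : Pt n) :
    HasGradientAt (evalFun q) (gradFun q x) x := by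
  rw [hasGradientAt_iff_hasFDerivAt]
  induction q using MvPolynomial.induction_on with
  | C a =>
    have h1 : evalFun (MvPolynomial.C a : MvPolynomial (Fin n) ℝ) = fun _ => a := by
      ext; simp [evalFun]
    have h2 : gradFun (MvPolynomial.C a : MvPolynomial (Fin n) ℝ) x = 0 := by
      ext; simp [gradFun, evalFun]
    rw [h1, h2, map_zero]
    exact hasFDerivAt_const a x
  | add p q hp hq =>
    have h1 : evalFun (p + q) = evalFun p + evalFun q := by ext; simp [evalFun]
    have h2 : gradFun (p + q) x = gradFun p x + gradFun q x := by ext; simp [gradFun, evalFun]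
    rw [h1, h2, map_add]
    exact hp.add hq
  | mul_X p i hp =>
    have h1 : evalFun (p * MvPolynomial.X i) = evalFun p * fun y => y i := by
      ext; simp [evalFun]
    have h2 : gradFun (p * MvPolynomial.X i) x
        = evalFun p x • EuclideanSpace.single i (1 : ℝ) + x i • gradFun p x := by
      ext j
      by_cases hij : j = i
      · subst hij; simp [gradFun, evalFun]
      · simp [gradFun, evalFun, hij]
    have h3 : HasFDerivAt (fun y : Pt n => y i)
        (InnerProductSpace.toDual ℝ (Pt n) (EuclideanSpace.single i (1 : ℝ))) x := by
      have : (InnerProductSpace.toDual ℝ (Pt n) (EuclideanSpace.single i (1 : ℝ)))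
          = EuclideanSpace.proj i := by
        ext y; simp [EuclideanSpace.inner_single_left]
      rw [this]
      exact (EuclideanSpace.proj i : Pt n →L[ℝ] ℝ).hasFDerivAt
    rw [h1, h2]
    simpa using hp.mul h3

theorem totalDegree_pderiv_le {σ R : Type*} [CommSemiring R] (i : σ) (q : MvPolynomial σ R) :
    (MvPolynomial.pderiv i q).totalDegree ≤ q.totalDegree := by
  classical
  conv_lhs => rw [q.as_sum, map_sum]
  refine MvPolynomial.totalDegree_finsetSum_le fun m hm => ?_
  rw [MvPolynomial.pderiv_monomial]
  refine (MvPolynomial.totalDegree_monomial_le _ _).trans ?_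
  refine le_trans ?_ (MvPolynomial.le_totalDegree hm)
  exact Finsupp.degree_mono tsub_le_self

/-- The restriction of a multivariate polynomial to a line is a polynomial. -/
theorem exists_polynomial_line {n : ℕ} (q : MvPolynomial (Fin n) ℝ) (x w : Pt n) :
    ∃ G : Polynomial ℝ, G.natDegree ≤ q.totalDegree ∧
      ∀ s : ℝ, G.eval s = evalFun q (x + s • w) := by
  refine ⟨MvPolynomial.aeval (fun j => Polynomial.C (x j) + Polynomial.C (w j) * Polynomial.X) q,
    ?_, fun s => ?_⟩
  · have := MvPolynomial.aeval_natDegree_le (n := 1) q le_rfl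
      (fun j => Polynomial.C (x j) + Polynomial.C (w j) * Polynomial.X) (fun j => ?_)
    · simpa using this
    · exact (Polynomial.natDegree_add_le _ _).trans (by
        simpa using (Polynomial.natDegree_C_mul_le _ _).trans Polynomial.natDegree_X_le)
  · rw [evalFun, ← Polynomial.coe_evalRingHom, MvPolynomial.aeval_def,
      MvPolynomial.hom_eval₂]
    rw [MvPolynomial.eval, MvPolynomial.coe_eval₂Hom]
    congr 1
    · exact RingHom.ext fun a => Polynomial.eval_C
    · funext j
      change Polynomial.eval s _ = _
      simp only [Polynomial.eval_add, Polynomial.eval_C, Polynomial.eval_mul, Polynomial.eval_X,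
        PiLp.add_apply, PiLp.smul_apply, smul_eq_mul]
      ring

/-! ### Hausdorff measure of simplices -/

theorem isCompact_hull {n : ℕ} (u : Finset (Pt n)) : IsCompact (hull u) :=
  u.finite_toSet.isCompact_convexHull ℝ

/-- Inside the affine span this measure is Lebesgue measure on the direction space, and the hull is
compact there. -/
theorem euclideanHausdorffMeasure_hull_lt_top {n : ℕ} {u : Finset (Pt n)} (hu : u.Nonempty) :
    μHE[Module.finrank ℝ (vectorSpan ℝ (u : Set (Pt n)))] (hull u) < ⊤ := by
  set S := affineSpan ℝ (u : Set (Pt n)) with hS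
  have hne : (S : Set (Pt n)).Nonempty := (affineSpan_nonempty ℝ).2 (by simpa using hu)
  have : Nonempty S := hne.to_subtype
  have hsub : hull u ⊆ S := convexHull_subset_affineSpan _
  have himg : hull u = Subtype.val '' (Subtype.val ⁻¹' hull u : Set S) := by
    exact (Subtype.image_preimage_coe _ _).trans (Set.inter_eq_right.2 hsub) |>.symm
  rw [← direction_affineSpan, ← hS, himg, AffineSubspace.euclideanHausdorffMeasure_coe_image]
  have hcpt : IsCompact (Subtype.val ⁻¹' hull u : Set S) :=
    (AffineSubspace.closed_of_finiteDimensional S).isClosedEmbedding_subtypeVal.isCompact_preimage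
      (isCompact_hull u)
  let p : S := Classical.arbitrary S
  rw [EuclideanGeometry.euclideanHausdorffMeasure_eq p,
    Measure.map_apply (IsometryEquiv.vaddConst p).continuous.measurable hcpt.measurableSet]
  exact ((IsometryEquiv.vaddConst p).toHomeomorph.isCompact_preimage.2 hcpt).measure_lt_top

theorem finrank_vectorSpan_finset {n k : ℕ} {u : Finset (Pt n)}
    (hi : AffineIndependent ℝ ((↑) : u → Pt n)) (hk : u.card = k + 1) :
    Module.finrank ℝ (vectorSpan ℝ (u : Set (Pt n))) = k := by
  have := hi.finrank_vectorSpan (n := k) (by simpa using hk)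
  have e : (u : Set (Pt n)) = Set.range ((↑) : u → Pt n) := Subtype.range_coe.symm
  exact (LinearEquiv.ofEq _ _ (congrArg (vectorSpan ℝ) e)).finrank_eq.trans this

theorem measure_hull_lt_top {n k : ℕ} {u : Finset (Pt n)}
    (hi : AffineIndependent ℝ ((↑) : u → Pt n)) (hk : u.card = k + 1) :
    μHE[k] (hull u) < ⊤ := by
  have h := euclideanHausdorffMeasure_hull_lt_top (u := u) (Finset.card_pos.1 (by omega))
  rwa [finrank_vectorSpan_finset hi hk] at h

theorem measure_hull_eq_zero {n k : ℕ} {u : Finset (Pt n)}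
    (hi : AffineIndependent ℝ ((↑) : u → Pt n)) (hk : u.card ≤ k) :
    μHE[k] (hull u) = 0 := by
  obtain rfl | hu := u.eq_empty_or_nonempty
  · simp [hull]
  · obtain ⟨m, hm⟩ := Nat.exists_eq_succ_of_ne_zero (Finset.card_pos.2 hu).ne'
    -- Finite measure in the simplex's own dimension `m < k` forces measure zero in dimension `k`.
    have h := measure_hull_lt_top hi hm
    exact (Measure.euclideanHausdorffMeasure_zero_or_top (show m < k by omega) (hull u)).resolve_right
      h.ne

/-! ### Trace inequality on a cone -/

/-- Comparison of the surface measure of a flat set `A`, transported along the segments towards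
an apex `x₀` at distance `d` from the hyperplane of `A`, with the volume measure. -/
theorem map_cone_le {n : ℕ} {A K : Set (Pt n)} (hAfin : μHE[n - 1] A < ⊤) (hK : MeasurableSet K) (hconv : Convex ℝ K) (hAK : A ⊆ K)
    {x₀ ν : Pt n} (hx₀ : x₀ ∈ K) (hν : ‖ν‖ = 1) {d : ℝ} (hd : 0 < d)
    (hplane : ∀ y ∈ A, inner ℝ (y - x₀) ν = d) :
    ENNReal.ofReal (d * (1 / 2) ^ (n - 1)) •
      Measure.map (fun z : ℝ × Pt n => z.2 + z.1 • (x₀ - z.2))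
        ((volume.restrict (Set.Icc (0 : ℝ) (1 / 2))).prod ((μHE[n - 1]).restrict A))
      ≤ volume.restrict K := by
  have : IsFiniteMeasure ((μHE[n - 1]).restrict A) := ⟨by simpa using hAfin⟩
  have hmeas : Measurable fun z : ℝ × Pt n => z.2 + z.1 • (x₀ - z.2) := by fun_prop
  refine Measure.le_intro fun B hB _ => ?_
  rw [Measure.smul_apply, Measure.map_apply hmeas hB, Measure.prod_apply (hmeas hB),
    Measure.restrict_apply hB, smul_eq_mul]
  have hv : (-d) • ν ≠ 0 := by
    rw [Ne, smul_eq_zero, not_or]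
    exact ⟨by linarith, by rintro rfl; simp at hν⟩
  -- Volume is sliced by hyperplanes orthogonal to `ν`, with `s = 0` at the plane of `A` and `s = 1`
  -- at the level of the apex.
  have hslice := EuclideanGeometry.euclideanHausdorffMeasure_eq_lintegral (x₀ + d • ν) hv
    (hB.inter hK)
  rw [finrank_euclideanSpace_fin, EuclideanSpace.euclideanHausdorffMeasure_eq_volume] at hslice
  have hnorm : ‖(-d) • ν‖ₑ = ENNReal.ofReal d := by
    rw [← ofReal_norm, norm_smul, hν, norm_neg, Real.norm_of_nonneg hd.le, mul_one]
  rw [hslice, hnorm, ENNReal.ofReal_mul hd.le, mul_assoc]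
  gcongr
  rw [← lintegral_const_mul' _ _ ENNReal.ofReal_ne_top]
  refine le_trans ?_ (setLIntegral_le_lintegral (Set.Icc (0 : ℝ) (1 / 2)) _)
  refine setLIntegral_mono' measurableSet_Icc fun s hs => ?_
  -- The slice at `s` contains a copy of `T` contracted by `1 - s`. Stopping at `s = 1/2` keeps the
  -- surface factor `(1 - s) ^ (n - 1)` bounded below.
  have h1s : (1 / 2 : ℝ) ≤ 1 - s := by linarith [hs.2]
  have hs' : Measurable fun y : Pt n => (s, y) := by fun_prop
  rw [Measure.restrict_apply (hs' (hmeas hB))]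
  set T : Set (Pt n) := Prod.mk s ⁻¹' ((fun z : ℝ × Pt n => z.2 + z.1 • (x₀ - z.2)) ⁻¹' B) ∩ A
  have hhom : ∀ y, AffineMap.homothety x₀ (1 - s) y = y + s • (x₀ - y) := by
    intro y
    rw [AffineMap.homothety_apply, vsub_eq_sub, vadd_eq_add]
    module
  have himg : AffineMap.homothety x₀ (1 - s) '' T ⊆ B ∩ K ∩
      (AffineSubspace.mk' (s • (-d) • ν +ᵥ (x₀ + d • ν)) (Submodule.span ℝ {(-d) • ν})ᗮ) := by
    rintro _ ⟨y, ⟨hyB, hyA⟩, rfl⟩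
    rw [hhom]
    refine ⟨⟨hyB, ?_⟩, ?_⟩
    · have := hconv (hAK hyA) hx₀ (show 0 ≤ 1 - s by linarith) hs.1 (by ring)
      convert this using 1
      module
    · rw [SetLike.mem_coe, AffineSubspace.mem_mk', Submodule.mem_orthogonal_singleton_iff_inner_left,
        vsub_eq_sub, vadd_eq_add]
      have e : y + s • (x₀ - y) - (s • (-d) • ν + (x₀ + d • ν))
          = (1 - s) • ((y - x₀) - d • ν) := by module
      rw [e, inner_smul_left, inner_smul_right, inner_sub_left, hplane y hyA, inner_smul_left,
        real_inner_self_eq_norm_sq, hν]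
      simp
  refine le_trans ?_ (measure_mono himg)
  rw [euclideanHausdorffMeasure_homothety_image _ _ (by linarith : (1 - s) ≠ 0), ENNReal.smul_def,
    smul_eq_mul]
  gcongr
  rw [ENNReal.ofReal, ENNReal.coe_le_coe, Real.toNNReal_le_iff_le_coe]
  push_cast
  rw [Real.norm_of_nonneg (by linarith)]
  gcongr

/-- A trace inequality on the cone over a flat set, from a one-dimensional inequality along the
generating segments. -/
theorem trace_le_of_segments {n : ℕ} {A K : Set (Pt n)} (hA : IsCompact A)
    (hAfin : μHE[n - 1] A < ⊤) (hK : IsCompact K) (hconv : Convex ℝ K) (hAK : A ⊆ K)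
    {x₀ ν : Pt n} (hx₀ : x₀ ∈ K) (hν : ‖ν‖ = 1) {d : ℝ} (hd : 0 < d)
    (hplane : ∀ y ∈ A, inner ℝ (y - x₀) ν = d)
    {f : Pt n → ℝ} (hf : Continuous f) (hf0 : ∀ x, 0 ≤ f x) {C : ℝ} (hC : 0 ≤ C)
    (hseg : ∀ y ∈ A, f y ≤ C * ∫ s in (0 : ℝ)..(1 / 2), f (y + s • (x₀ - y))) :
    d * (1 / 2) ^ (n - 1) * ∫ x in A, f x ∂μHE[n - 1] ≤ C * ∫ x in K, f x := by
  have : IsFiniteMeasure ((μHE[n - 1]).restrict A) := ⟨by simpa using hAfin⟩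
  have hiA : IntegrableOn f A μHE[n - 1] := by
    obtain ⟨b, hb⟩ := hA.exists_bound_of_continuousOn hf.continuousOn
    exact IntegrableOn.of_bound hAfin hf.aestronglyMeasurable b
      ((ae_restrict_iff' hA.measurableSet).2 (Filter.Eventually.of_forall hb))
  have hiK : IntegrableOn f K := hf.continuousOn.integrableOn_compact hK
  have hc0 : 0 ≤ d * (1 / 2) ^ (n - 1) := by positivity
  have hK0 : 0 ≤ ∫ x in K, f x := integral_nonneg hf0
  rw [← ENNReal.ofReal_le_ofReal_iff (by positivity), ENNReal.ofReal_mul hc0, ENNReal.ofReal_mul hC,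
    ofReal_integral_eq_lintegral_ofReal hiA (Filter.Eventually.of_forall hf0),
    ofReal_integral_eq_lintegral_ofReal hiK (Filter.Eventually.of_forall hf0)]
  have hfm : Measurable fun x => ENNReal.ofReal (f x) := hf.measurable.ennreal_ofReal
  have hmeas : Measurable fun z : ℝ × Pt n => z.2 + z.1 • (x₀ - z.2) := by fun_prop
  have h1 : ∫⁻ y in A, ENNReal.ofReal (f y) ∂μHE[n - 1] ≤ ENNReal.ofReal C *
      ∫⁻ y in A, (∫⁻ s in Set.Icc (0 : ℝ) (1 / 2), ENNReal.ofReal (f (y + s • (x₀ - y))))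
        ∂μHE[n - 1] := by
    rw [← lintegral_const_mul' _ _ ENNReal.ofReal_ne_top]
    refine setLIntegral_mono' hA.measurableSet fun y hy => ?_
    have hcy : Continuous fun s : ℝ => f (y + s • (x₀ - y)) := by fun_prop
    rw [← ofReal_integral_eq_lintegral_ofReal
      (hcy.continuousOn.integrableOn_compact isCompact_Icc)
      (Filter.Eventually.of_forall fun s => hf0 _), ← ENNReal.ofReal_mul hC]
    refine ENNReal.ofReal_le_ofReal ((hseg y hy).trans_eq ?_)
    rw [intervalIntegral.integral_of_le (by norm_num), integral_Icc_eq_integral_Ioc]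
  -- Tonelli, with the double integral read as an integral against the pushforward under the cone
  -- map.
  have h2 : ∫⁻ y in A, (∫⁻ s in Set.Icc (0 : ℝ) (1 / 2), ENNReal.ofReal (f (y + s • (x₀ - y))))
      ∂μHE[n - 1] = ∫⁻ x, ENNReal.ofReal (f x) ∂(Measure.map
        (fun z : ℝ × Pt n => z.2 + z.1 • (x₀ - z.2))
        ((volume.restrict (Set.Icc (0 : ℝ) (1 / 2))).prod ((μHE[n - 1]).restrict A))) := by
    rw [lintegral_map hfm hmeas]
    exact (lintegral_prod_symm' _ (hfm.comp hmeas)).symm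
  have h3 := lintegral_mono' (map_cone_le hAfin hK.measurableSet hconv hAK hx₀ hν
    hd hplane) (le_refl fun x => ENNReal.ofReal (f x))
  rw [lintegral_smul_measure, ← h2, smul_eq_mul] at h3
  exact (mul_le_mul_right h1 _).trans ((mul_left_comm _ _ _).le.trans (mul_le_mul_right h3 _))

/-! ### Facets of simplices -/

/-- The relative interior of a simplex: the points of no proper face. -/
def relHull {n : ℕ} (t : Finset (Pt n)) : Set (Pt n) :=
  hull t \ ⋃ b ∈ t, convexHull ℝ ((t : Set (Pt n)) \ {b})

theorem ae_mem_relHull {n k : ℕ} {t : Finset (Pt n)} (hi : AffineIndependent ℝ ((↑) : t → Pt n))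
    (hk : t.card = k + 1) : ∀ᵐ x ∂((μHE[k]).restrict (hull t)), x ∈ relHull t := by
  classical
  have hnull : ∀ b ∈ t, μHE[k] (convexHull ℝ ((t : Set (Pt n)) \ {b})) = 0 := by
    intro b hb
    have h := measure_hull_eq_zero (u := t.erase b) (k := k)
      (hi.mono (s := ((t.erase b : Finset (Pt n)) : Set (Pt n))) (by simp))
      (by rw [Finset.card_erase_of_mem hb]; omega)
    rwa [hull, Finset.coe_erase] at h
  have h0 : μHE[k] (⋃ b ∈ t, convexHull ℝ ((t : Set (Pt n)) \ {b})) = 0 :=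
    (measure_biUnion_null_iff t.countable_toSet).2 hnull
  rw [ae_restrict_iff' (isCompact_hull t).measurableSet]
  filter_upwards [compl_mem_ae_iff.2 h0] with x hx hxt using ⟨hxt, hx⟩

theorem affineSpan_eq_top_of_card {n : ℕ} {s : Finset (Pt n)}
    (hi : AffineIndependent ℝ ((↑) : s → Pt n)) (hs : s.card = n + 1) :
    affineSpan ℝ (s : Set (Pt n)) = ⊤ := by
  have := hi.affineSpan_eq_top_iff_card_eq_finrank_add_one.2 (by simpa using hs)
  rwa [Subtype.range_coe] at this

theorem interior_hull_nonempty {n : ℕ} {s : Finset (Pt n)}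
    (hi : AffineIndependent ℝ ((↑) : s → Pt n)) (hs : s.card = n + 1) :
    (interior (hull s)).Nonempty :=
  interior_convexHull_nonempty_iff_affineSpan_eq_top.2 (affineSpan_eq_top_of_card hi hs)

theorem closure_interior_hull {n : ℕ} {s : Finset (Pt n)}
    (hi : AffineIndependent ℝ ((↑) : s → Pt n)) (hs : s.card = n + 1) :
    closure (interior (hull s)) = hull s := by
  have hc : Convex ℝ (hull s) := convex_convexHull ℝ _
  rw [hc.closure_interior_eq_closure_of_nonempty_interior (interior_hull_nonempty hi hs),
    (isCompact_hull s).isClosed.closure_eq]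

/-- The barycentric coordinate of an `n`-simplex that belongs to the vertex opposite to the
facet `t`. -/
theorem exists_facet_coord {n : ℕ} {s t : Finset (Pt n)}
    (hi : AffineIndependent ℝ ((↑) : s → Pt n)) (hs : s.card = n + 1) (hts : t ⊆ s)
    (ht : t.card = n) :
    ∃ a ∈ s, (∀ x ∈ s, x = a ∨ x ∈ t) ∧ ∃ ℓ : Pt n →ᵃ[ℝ] ℝ, ℓ a = 1 ∧ (∀ y ∈ hull t, ℓ y = 0) ∧
      (∀ y ∈ hull s, 0 ≤ ℓ y) ∧
      ∀ x ∈ relHull t, ∀ᶠ y in nhds x, (y ∈ hull s ↔ 0 ≤ ℓ y) := by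
  classical
  obtain ⟨a, has, hat⟩ : ∃ a ∈ s, a ∉ t := by
    by_contra! h
    have := Finset.card_le_card h
    omega
  have hsa : s = insert a t := by
    refine (Finset.eq_of_subset_of_card_le (Finset.insert_subset has hts) ?_).symm
    rw [Finset.card_insert_of_notMem hat]
    omega
  let b : AffineBasis s ℝ (Pt n) := ⟨(↑), hi, by
    rw [Subtype.range_coe]
    exact affineSpan_eq_top_of_card hi hs⟩
  have hbr : Set.range b = (s : Set (Pt n)) := Subtype.range_coe
  have hull_iff : ∀ y, y ∈ hull s ↔ ∀ i, 0 ≤ b.coord i y := by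
    intro y
    have := b.convexHull_eq_nonneg_coord
    rw [hbr] at this
    exact Set.ext_iff.1 this y
  let i₀ : s := ⟨a, has⟩
  have hzero : ∀ y ∈ hull t, b.coord i₀ y = 0 := by
    have hconv : Convex ℝ {y | b.coord i₀ y = 0} :=
      (convex_singleton (0 : ℝ)).affine_preimage (b.coord i₀)
    refine fun y hy => convexHull_min (s := (t : Set (Pt n))) ?_ hconv hy
    intro z hz
    have hz' : z ∈ s := hts hz
    exact b.coord_apply_ne (i := i₀) (j := ⟨z, hz'⟩)
      (fun h => hat (by rwa [show a = z from Subtype.ext_iff.1 h]))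
  have hst : ∀ x ∈ s, x = a ∨ x ∈ t := fun x hx => by rw [hsa] at hx; simpa using hx
  refine ⟨a, has, hst, b.coord i₀,
    b.coord_apply_eq i₀, hzero, fun y hy => (hull_iff y).1 hy i₀, fun x hx => ?_⟩
  have hxs : x ∈ hull s := convexHull_mono (by exact_mod_cast hts) hx.1
  -- If the coordinate of another vertex `i` vanished, `x` would be a convex combination of `t`
  -- without `i`, hence on a proper face. Positivity persists nearby, so only the sign of `ℓ` then
  -- decides membership.
  have hpos : ∀ i : s, i ≠ i₀ → 0 < b.coord i x := by
    intro i hne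
    refine lt_of_le_of_ne ((hull_iff x).1 hxs i) fun h0 => hx.2 ?_
    have hit : (i : Pt n) ∈ t := (hst i i.2).resolve_left fun h => hne (Subtype.ext h)
    refine Set.mem_iUnion₂.2 ⟨i, hit, ?_⟩
    have hnot : ∀ j : s, b.coord j x ≠ 0 → (j : Pt n) ∈ (t : Set (Pt n)) \ {(i : Pt n)} := by
      intro j hj
      have hji : j ≠ i := fun h => hj (h ▸ h0.symm)
      have hji₀ : j ≠ i₀ := fun h => hj (h ▸ hzero x hx.1)
      exact ⟨(hst j j.2).resolve_left fun h => hji₀ (Subtype.ext h), fun h => hji (Subtype.ext h)⟩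
    have hsum := b.linear_combination_coord_eq_self x
    rw [← Finset.sum_filter_of_ne (p := fun j => b.coord j x ≠ 0)
      (fun j _ h h' => h (by rw [h', zero_smul]))] at hsum
    rw [← hsum]
    refine (convex_convexHull ℝ _).sum_mem (fun j _ => (hull_iff x).1 hxs j) ?_
      fun j hj => subset_convexHull ℝ _ (hnot j (Finset.mem_filter.1 hj).2)
    rw [Finset.sum_filter_of_ne (fun j _ h => h)]
    exact b.sum_coord_apply_eq_one x
  have hev : ∀ i : s, i ≠ i₀ → ∀ᶠ y in nhds x, 0 < b.coord i y := fun i hne =>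
    (b.coord i).continuous_of_finiteDimensional.continuousAt.eventually (lt_mem_nhds (hpos i hne))
  have hev' : ∀ᶠ y in nhds x, ∀ i : s, i ≠ i₀ → 0 < b.coord i y :=
    Filter.eventually_all.2 fun i => by
      by_cases h : i = i₀
      · exact Filter.Eventually.of_forall fun y hy => absurd h hy
      · filter_upwards [hev i h] with y hy _ using hy
  filter_upwards [hev'] with y hy
  rw [hull_iff]
  refine ⟨fun h => h i₀, fun h i => ?_⟩
  by_cases hi' : i = i₀
  · exact hi' ▸ h
  · exact (hy i hi').le

/-- An affine function on Euclidean space, in terms of its gradient. -/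
theorem exists_affine_gradient {n : ℕ} (ℓ : Pt n →ᵃ[ℝ] ℝ) :
    ∃ g : Pt n, ∀ x y, ℓ y - ℓ x = inner ℝ (y - x) g := by
  refine ⟨(InnerProductSpace.toDual ℝ (Pt n)).symm ℓ.linear.toContinuousLinearMap, fun x y => ?_⟩
  rw [real_inner_comm, InnerProductSpace.toDual_symm_apply]
  have := ℓ.linearMap_vsub y x
  simpa using this.symm

/-! ### Trace inequality on a simplex -/

/-- The discrete trace inequality for the gradient of a polynomial on a facet of a simplex. -/
theorem simplex_trace_le {n p : ℕ} {s t : Finset (Pt n)}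
    (hi : AffineIndependent ℝ ((↑) : s → Pt n)) (hs : s.card = n + 1) (hts : t ⊆ s)
    (ht : t.card = n) (hn : 1 ≤ n) {x₀ : Pt n} {r : ℝ} (hr : 0 < r)
    (hball : Metric.closedBall x₀ r ⊆ hull s) {C : ℝ} (hC : 0 ≤ C)
    (hCp : ∀ G : Polynomial ℝ, G.natDegree ≤ p →
      G.eval 0 ^ 2 ≤ C * ∫ s in (0 : ℝ)..(1 / 2), G.eval s ^ 2)
    (q : MvPolynomial (Fin n) ℝ) (hq : q.totalDegree ≤ p) :
    r * (1 / 2) ^ (n - 1) * ∫ x in hull t, ‖gradFun q x‖ ^ 2 ∂μHE[n - 1]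
      ≤ C * ∫ x in hull s, ‖gradFun q x‖ ^ 2 := by
  obtain ⟨a, has, -, ℓ, ha, hzero, hnonneg, -⟩ := exists_facet_coord hi hs hts ht
  obtain ⟨g, hg⟩ := exists_affine_gradient ℓ
  have hit : AffineIndependent ℝ ((↑) : t → Pt n) := hi.mono (by exact_mod_cast hts)
  obtain ⟨z, hz⟩ : t.Nonempty := Finset.card_pos.1 (by omega)
  have hzt : z ∈ hull t := subset_convexHull ℝ _ hz
  have hg0 : 0 < ‖g‖ := by
    rw [norm_pos_iff]
    rintro rfl
    have := hg z a
    rw [ha, hzero z hzt] at this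
    simp at this
  set d : ℝ := ℓ x₀ / ‖g‖ with hd
  -- `d` is the distance from the ball's centre to the facet plane. The point of the ball lowest in
  -- the direction of `g` still satisfies `0 ≤ ℓ`, which gives `r ≤ d`.
  have hrd : r ≤ d := by
    have hmem : x₀ - (r / ‖g‖) • g ∈ hull s := by
      apply hball
      rw [Metric.mem_closedBall, dist_eq_norm, sub_sub_cancel_left, norm_neg, norm_smul,
        norm_div, norm_norm, Real.norm_of_nonneg hr.le]
      field_simp
      exact le_rfl
    have h1 := hg x₀ (x₀ - (r / ‖g‖) • g)
    rw [sub_sub_cancel_left, inner_neg_left, real_inner_smul_left, real_inner_self_eq_norm_sq] at h1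
    have h2 := hnonneg _ hmem
    have h3 : r / ‖g‖ * ‖g‖ ^ 2 = r * ‖g‖ := by field_simp
    rw [hd, le_div_iff₀ hg0]
    linarith
  have hgrad : ∀ y, ‖gradFun q y‖ ^ 2 = ∑ j, evalFun (MvPolynomial.pderiv j q) y ^ 2 :=
    norm_sq_gradFun q
  have key := trace_le_of_segments (A := hull t) (K := hull s) (x₀ := x₀) (ν := -(‖g‖⁻¹ • g))
    (d := d) (f := fun y => ‖gradFun q y‖ ^ 2) (C := C) (isCompact_hull t)
    (measure_hull_lt_top hit (by omega)) (isCompact_hull s) (convex_convexHull ℝ _)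
    (convexHull_mono (by exact_mod_cast hts)) (hball (Metric.mem_closedBall_self hr.le))
    (by rw [norm_neg, norm_smul, norm_inv, norm_norm, inv_mul_cancel₀ hg0.ne'])
    (hr.trans_le hrd) ?_ ((continuous_gradFun q).norm.pow 2) (fun _ => by positivity) hC ?_
  · refine le_trans ?_ key
    exact mul_le_mul_of_nonneg_right (mul_le_mul_of_nonneg_right hrd (by positivity))
      (integral_nonneg fun _ => sq_nonneg _)
  · intro y hy
    have := hg x₀ y
    rw [hzero y hy] at this
    rw [inner_neg_right, real_inner_smul_right, ← this, hd]
    field_simp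
    ring
  · intro y _
    choose G hG hGe using fun j => exists_polynomial_line (MvPolynomial.pderiv j q) y (x₀ - y)
    simp only [hgrad, ← hGe]
    rw [intervalIntegral.integral_finsetSum
      fun j _ => (by fun_prop : Continuous _).intervalIntegrable _ _, Finset.mul_sum]
    refine Finset.sum_le_sum fun j _ => ?_
    have h0 := hGe j 0
    rw [zero_smul, add_zero] at h0
    rw [← h0]
    exact hCp (G j) ((hG j).trans ((totalDegree_pderiv_le j q).trans hq))

/-! ### Local geometry of the mesh at the interface -/

namespace InterfaceMesh

variable {n : ℕ} (M : InterfaceMesh n)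

theorem mem_cells {i : Fin 2} {s : Finset (Pt n)} :
    s ∈ M.cells i ↔ s ∈ (M.T i).faces ∧ s.card = n + 1 := by
  simp [cells]

theorem mem_interfaceFaces {t : Finset (Pt n)} :
    t ∈ M.interfaceFaces ↔ t ∈ (M.T 0).faces ∧ t.card = n ∧ hull t ⊆ M.Γ := by
  simp [interfaceFaces]

theorem indep_of_mem_cells {i : Fin 2} {s : Finset (Pt n)} (hs : s ∈ M.cells i) :
    AffineIndependent ℝ ((↑) : s → Pt n) :=
  (M.T i).indep ((M.mem_cells).1 hs).1

theorem exists_cell {i : Fin 2} {t : Finset (Pt n)} (ht : t ∈ (M.T i).faces) :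
    ∃ s ∈ M.cells i, t ⊆ s := by
  obtain ⟨s, hs, hc, hts⟩ := M.pure i t ht
  exact ⟨s, (M.mem_cells).2 ⟨hs, hc⟩, hts⟩

theorem mem_space_iff {i : Fin 2} {x : Pt n} :
    x ∈ (M.T i).space ↔ ∃ s ∈ M.cells i, x ∈ hull s := by
  rw [Geometry.SimplicialComplex.mem_space_iff]
  constructor
  · rintro ⟨t, ht, hx⟩
    obtain ⟨s, hs, hts⟩ := M.exists_cell ht
    exact ⟨s, hs, convexHull_mono (by exact_mod_cast hts) hx⟩
  · rintro ⟨s, hs, hx⟩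
    exact ⟨s, ((M.mem_cells).1 hs).1, hx⟩

theorem space_eq (i : Fin 2) : (M.T i).space = ⋃ s ∈ M.cells i, hull s := by
  ext x
  simp [M.mem_space_iff]

theorem hull_subset_space {i : Fin 2} {s : Finset (Pt n)} (hs : s ∈ M.cells i) :
    hull s ⊆ (M.T i).space := fun _ hx => (M.mem_space_iff).2 ⟨s, hs, hx⟩

theorem isClosed_space (i : Fin 2) : IsClosed (M.T i).space := by
  rw [M.space_eq]
  exact (M.cells i).finite_toSet.isClosed_biUnion fun s _ => (isCompact_hull s).isClosed

/-- Purity is what makes this true: every point of the mesh lies in a full-dimensional cell, which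
is the closure of its interior. -/
theorem closure_Ω (i : Fin 2) : closure (M.Ω i) = (M.T i).space := by
  refine (closure_minimal interior_subset (M.isClosed_space i)).antisymm fun x hx => ?_
  obtain ⟨s, hs, hxs⟩ := (M.mem_space_iff).1 hx
  rw [← closure_interior_hull (M.indep_of_mem_cells hs) ((M.mem_cells).1 hs).2] at hxs
  exact closure_mono (interior_mono (M.hull_subset_space hs)) hxs

theorem Γ_subset_space (i : Fin 2) : M.Γ ⊆ (M.T i).space := by
  rw [← M.closure_Ω]
  fin_cases i
  · exact Set.inter_subset_left.trans frontier_subset_closure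
  · exact Set.inter_subset_right.trans frontier_subset_closure

theorem notMem_Ω_of_mem_Γ {x : Pt n} (hx : x ∈ M.Γ) : x ∉ M.Ω 0 := by
  have h := hx.1
  rw [IsOpen.frontier_eq (show IsOpen (M.Ω 0) from isOpen_interior)] at h
  exact h.2

/-- By conformity a second element containing `x` would also have `t` as a facet. Two elements on
opposite sides of `t` would make `x` interior to the subdomain, although it lies on `Γ`; two on the
same side would overlap outside their common face. -/
theorem notMem_hull_of_ne {s s' t : Finset (Pt n)} (ht : t ∈ M.interfaceFaces)
    (hs : s ∈ M.cells 0) (hts : t ⊆ s) {x : Pt n} (hx : x ∈ relHull t) (hs' : s' ∈ M.cells 0)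
    (hne : s' ≠ s) : x ∉ hull s' := by
  intro hxs'
  obtain ⟨htf, htc, htΓ⟩ := (M.mem_interfaceFaces).1 ht
  obtain ⟨hsf, hsc⟩ := (M.mem_cells).1 hs
  obtain ⟨hsf', hsc'⟩ := (M.mem_cells).1 hs'
  have hts' : t ⊆ s' := by
    by_contra h
    obtain ⟨b, hbt, hbs'⟩ := Finset.not_subset.1 h
    refine hx.2 (Set.mem_iUnion₂.2 ⟨b, hbt, ?_⟩)
    refine convexHull_mono ?_ ((M.T 0).inter_subset_convexHull htf hsf' ⟨hx.1, hxs'⟩)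
    rintro y ⟨hyt, hys'⟩
    exact ⟨hyt, fun h => hbs' (h ▸ hys')⟩
  obtain ⟨a, has, hst, ℓ, ha, hzero, -, hnear⟩ :=
    exists_facet_coord (M.indep_of_mem_cells hs) hsc hts htc
  obtain ⟨a', -, -, ℓ', ha', hzero', -, hnear'⟩ :=
    exists_facet_coord (M.indep_of_mem_cells hs') hsc' hts' htc
  -- Both affine functions vanish on `t`, so they are proportional; the sign of `ℓ' a` tells on
  -- which side of `t` the second element lies.
  have hprop : ∀ y, ℓ' y = ℓ' a * ℓ y := by
    have h : ℓ' = ℓ' a • ℓ := by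
      refine AffineMap.ext_on (affineSpan_eq_top_of_card (M.indep_of_mem_cells hs) hsc) ?_
      intro y hy
      rcases hst y hy with rfl | hyt
      · simp [ha]
      · have hyh : y ∈ hull t := subset_convexHull ℝ _ hyt
        simp [hzero y hyh, hzero' y hyh]
    intro y
    have := congrArg (fun f : Pt n →ᵃ[ℝ] ℝ => f y) h
    simpa using this
  have has' : a ∉ s' := by
    intro h
    refine hne (Finset.eq_of_subset_of_card_le (fun y hy => ?_) (by omega)).symm
    rcases hst y hy with rfl | hyt
    · exact h
    · exact hts' hyt
  have hc : ℓ' a ≠ 0 := by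
    intro h0
    have := hprop a'
    rw [ha', h0, zero_mul] at this
    exact one_ne_zero this
  rcases lt_or_gt_of_ne hc with hneg | hpos
  · refine M.notMem_Ω_of_mem_Γ (htΓ hx.1) (mem_interior_iff_mem_nhds.2 ?_)
    filter_upwards [hnear x hx, hnear' x hx] with y h1 h2
    rcases le_or_gt 0 (ℓ y) with h | h
    · exact M.hull_subset_space hs (h1.2 h)
    · exact M.hull_subset_space hs' (h2.2 (by rw [hprop]; nlinarith))
  -- Moving slightly from `x` towards `a` gives a point of both elements with `ℓ = ε > 0`, while
  -- their intersection lies in `hull t`, where `ℓ = 0`.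
  · have hlim : Filter.Tendsto (fun ε : ℝ => AffineMap.lineMap x a ε)
        (nhdsWithin 0 (Set.Ioi 0)) (nhds x) := by
      have hcont : Continuous fun ε : ℝ => AffineMap.lineMap x a ε := AffineMap.lineMap_continuous
      have := (hcont.tendsto 0).mono_left (nhdsWithin_le_nhds (s := Set.Ioi (0 : ℝ)))
      simpa using this
    obtain ⟨ε, ⟨h1, h2⟩, hε⟩ := ((hlim.eventually ((hnear x hx).and (hnear' x hx))).and
      self_mem_nhdsWithin).exists
    have hε : 0 < ε := hε
    have hval : ℓ (AffineMap.lineMap x a ε) = ε := by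
      rw [AffineMap.apply_lineMap, hzero x hx.1, ha]
      simp [AffineMap.lineMap_apply]
    have hy := (M.T 0).inter_subset_convexHull hsf hsf'
      ⟨h1.2 (by rw [hval]; exact hε.le), h2.2 (by rw [hprop, hval]; positivity)⟩
    have hy' : AffineMap.lineMap x a ε ∈ hull t := by
      refine convexHull_mono ?_ hy
      rintro y ⟨hys, hys'⟩
      exact (hst y hys).resolve_left fun h => has' (h ▸ hys')
    rw [hzero _ hy'] at hval
    exact hε.ne hval

/-- Near the relative interior of an interface face only one element is present. -/
theorem eventually_mem_space_iff {s t : Finset (Pt n)} (ht : t ∈ M.interfaceFaces)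
    (hs : s ∈ M.cells 0) (hts : t ⊆ s) {x : Pt n} (hx : x ∈ relHull t) :
    ∀ᶠ y in nhds x, (y ∈ (M.T 0).space ↔ y ∈ hull s) := by
  have h : ∀ᶠ y in nhds x, ∀ s' ∈ M.cells 0, s' ≠ s → y ∉ hull s' := by
    refine (Filter.eventually_all_finset _).2 fun s' hs' => ?_
    by_cases hne : s' = s
    · exact Filter.Eventually.of_forall fun y h => absurd hne h
    · filter_upwards [(isCompact_hull s').isClosed.isOpen_compl.mem_nhds
        (M.notMem_hull_of_ne ht hs hts hx hs' hne)] with y hy _ using hy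
  filter_upwards [h] with y hy
  rw [M.mem_space_iff]
  refine ⟨fun ⟨s', hs', hys'⟩ => ?_, fun h => ⟨s, hs, h⟩⟩
  by_contra hys
  exact hy s' hs' (fun h => hys (h ▸ hys')) hys'

/-- The outward unit normal is constant on the relative interior of an interface face. -/
theorem exists_outwardNormal_eq {t : Finset (Pt n)} (ht : t ∈ M.interfaceFaces) :
    ∃ ν : Pt n, ∀ x ∈ relHull t, outwardNormal (M.Ω 0) x = ν := by
  obtain ⟨htf, htc, -⟩ := (M.mem_interfaceFaces).1 ht
  obtain ⟨s, hs, hts⟩ := M.exists_cell htf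
  obtain ⟨a, -, -, ℓ, ha, hzero, -, hnear⟩ :=
    exists_facet_coord (M.indep_of_mem_cells hs) ((M.mem_cells).1 hs).2 hts htc
  obtain ⟨g, hg⟩ := exists_affine_gradient ℓ
  refine ⟨-(‖g‖⁻¹ • g), fun x hx => ?_⟩
  have hg0 : 0 < ‖g‖ := by
    rw [norm_pos_iff]
    rintro rfl
    have := hg x a
    rw [ha, hzero x hx.1] at this
    simp at this
  have hev : ∀ᶠ y in nhds x, (y ∈ (M.T 0).space ↔ 0 ≤ ℓ y) := by
    filter_upwards [M.eventually_mem_space_iff ht hs hts hx, hnear x hx] with y h1 h2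
    rw [h1, h2]
  -- Passing from the closed mesh to its interior turns the closed half-space into the open one: a
  -- point with `ℓ y ≤ 0` leaves the mesh when moved along `-g`.
  have hΩ : ∀ᶠ y in nhds x, (y ∈ M.Ω 0 ↔ 0 < ℓ y) := by
    filter_upwards [eventually_eventually_nhds.2 hev] with y hy
    rw [Ω, mem_interior_iff_mem_nhds]
    constructor
    · intro hmem
      have hlim : Filter.Tendsto (fun ε : ℝ => y - ε • g) (nhdsWithin 0 (Set.Ioi 0)) (nhds y) := by
        have hcont : Continuous fun ε : ℝ => y - ε • g := by fun_prop
        have := (hcont.tendsto 0).mono_left (nhdsWithin_le_nhds (s := Set.Ioi (0 : ℝ)))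
        simpa using this
      have hmem' : ∀ᶠ z in nhds y, z ∈ (M.T 0).space := hmem
      obtain ⟨ε, ⟨h1, h2⟩, hε⟩ := ((hlim.eventually (hy.and hmem')).and
        self_mem_nhdsWithin).exists
      have hε : 0 < ε := hε
      have h3 := h1.1 h2
      have h4 := hg y (y - ε • g)
      rw [sub_sub_cancel_left, inner_neg_left, real_inner_smul_left,
        real_inner_self_eq_norm_sq] at h4
      have : 0 < ε * ‖g‖ ^ 2 := by positivity
      linarith
    · intro hpos
      filter_upwards [hy, ℓ.continuous_of_finiteDimensional.continuousAt.eventually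
        (lt_mem_nhds hpos)] with z h1 h2
      exact h1.2 h2.le
  have hnormal : IsOutwardNormal (M.Ω 0) x (-(‖g‖⁻¹ • g)) := by
    refine ⟨by rw [norm_neg, norm_smul, norm_inv, norm_norm, inv_mul_cancel₀ hg0.ne'], ?_⟩
    filter_upwards [hΩ] with y hy
    have := hg x y
    rw [hzero x hx.1, sub_zero] at this
    rw [hy, inner_neg_right, real_inner_smul_right, ← this, neg_lt_zero]
    exact (mul_pos_iff_of_pos_left (inv_pos.2 hg0)).symm
  have hex : ∃ ν, IsOutwardNormal (M.Ω 0) x ν := ⟨_, hnormal⟩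
  rw [outwardNormal, dif_pos hex]
  exact hex.choose_spec.unique hnormal

theorem norm_outwardNormal_le (Ω : Set (Pt n)) (x : Pt n) : ‖outwardNormal Ω x‖ ≤ 1 := by
  rw [outwardNormal]
  split_ifs with h
  · exact h.choose_spec.1.le
  · simp

theorem gradientWithin_closure_Ω {s t : Finset (Pt n)} (ht : t ∈ M.interfaceFaces)
    (hs : s ∈ M.cells 0) (hts : t ⊆ s) {v : Pt n → ℝ} {q : MvPolynomial (Fin n) ℝ}
    (hv : ∀ x ∈ hull s, v x = evalFun q x) {x : Pt n} (hx : x ∈ relHull t) :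
    gradientWithin v (closure (M.Ω 0)) x = gradFun q x := by
  have hxs : x ∈ hull s := convexHull_mono (by exact_mod_cast hts) hx.1
  have hset : closure (M.Ω 0) =ᶠ[nhds x] hull s := by
    rw [M.closure_Ω]
    filter_upwards [M.eventually_mem_space_iff ht hs hts hx] with y hy
    exact propext hy
  have huniq : UniqueDiffWithinAt ℝ (hull s) x :=
    uniqueDiffWithinAt_convex (convex_convexHull ℝ _)
      (interior_hull_nonempty (M.indep_of_mem_cells hs) ((M.mem_cells).1 hs).2)
      (subset_closure hxs)
  have hderiv : HasFDerivWithinAt v (InnerProductSpace.toDual ℝ (Pt n) (gradFun q x))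
      (hull s) x :=
    ((hasGradientAt_iff_hasFDerivAt.1 (hasGradientAt_evalFun q x)).hasFDerivWithinAt).congr hv
      (hv x hxs)
  rw [gradientWithin, fderivWithin_congr_set hset, hderiv.fderivWithin huniq,
    LinearIsometryEquiv.symm_apply_apply]

/-- The gradient of a piecewise polynomial inside an element. -/
theorem gradient_eq_gradFun {s : Finset (Pt n)} {v : Pt n → ℝ} {q : MvPolynomial (Fin n) ℝ}
    (hv : ∀ x ∈ hull s, v x = evalFun q x) {x : Pt n} (hx : x ∈ interior (hull s)) :
    gradient v x = gradFun q x := by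
  refine ((hasGradientAt_evalFun q x).congr_of_eventuallyEq ?_).gradient
  filter_upwards [mem_interior_iff_mem_nhds.1 hx] with y hy using hv y hy

theorem gradient_ae_eq_gradFun {s : Finset (Pt n)} {v : Pt n → ℝ} {q : MvPolynomial (Fin n) ℝ}
    (hv : ∀ x ∈ hull s, v x = evalFun q x) :
    gradient v =ᵐ[volume.restrict (hull s)] gradFun q := by
  have hconv : Convex ℝ (hull s) := convex_convexHull ℝ _
  rw [Filter.EventuallyEq, ae_restrict_iff' (isCompact_hull s).measurableSet]
  filter_upwards [compl_mem_ae_iff.2 (hconv.addHaar_frontier volume)] with x hx hxs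
  refine gradient_eq_gradFun hv ?_
  by_contra h
  exact hx ⟨subset_closure hxs, h⟩

end InterfaceMesh

/-! ### Splitting integrals over elements and faces -/

theorem integrableOn_hull {n k : ℕ} {t : Finset (Pt n)}
    (hi : AffineIndependent ℝ ((↑) : t → Pt n)) (hk : t.card = k + 1) {f : Pt n → ℝ}
    (hf : ContinuousOn f (hull t)) : IntegrableOn f (hull t) μHE[k] := by
  obtain ⟨b, hb⟩ := (isCompact_hull t).exists_bound_of_continuousOn hf
  have hm := (isCompact_hull t).measurableSet
  exact IntegrableOn.of_bound (measure_hull_lt_top hi hk) (hf.aestronglyMeasurable hm) b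
    ((ae_restrict_iff' hm).2 (Filter.Eventually.of_forall hb))

/-- The integral over a union of simplices of the same dimension of a simplicial complex. -/
theorem setIntegral_biUnion_hull {n k : ℕ} {K : Geometry.SimplicialComplex ℝ (Pt n)}
    {F : Finset (Finset (Pt n))} (hF : ∀ t ∈ F, t ∈ K.faces ∧ t.card = k + 1) {f : Pt n → ℝ}
    (hf : ∀ t ∈ F, IntegrableOn f (hull t) μHE[k]) :
    ∫ x in ⋃ t ∈ F, hull t, f x ∂μHE[k] = ∑ t ∈ F, ∫ x in hull t, f x ∂μHE[k] := by
  classical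
  induction F using Finset.induction_on with
  | empty => simp
  | insert a F haF ih =>
    simp only [Finset.forall_mem_insert] at hF hf
    -- Two distinct simplices of equal dimension meet in the hull of strictly fewer vertices, which
    -- is null.
    have hdisj : AEDisjoint μHE[k] (hull a) (⋃ t ∈ F, hull t) := by
      rw [AEDisjoint, Set.inter_iUnion₂]
      refine (measure_biUnion_null_iff F.countable_toSet).2 fun t ht => ?_
      refine measure_mono_null (K.inter_subset_convexHull hF.1.1 (hF.2 t ht).1) ?_
      rw [← Finset.coe_inter]
      refine measure_hull_eq_zero ((K.indep hF.1.1).mono (s := ((a ∩ t : Finset (Pt n)) : Set _))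
        (by simp)) ?_
      by_contra! h
      have h1 : a ∩ t = a := Finset.eq_of_subset_of_card_le Finset.inter_subset_left
        (by rw [hF.1.2]; omega)
      have h2 : a ∩ t = t := Finset.eq_of_subset_of_card_le Finset.inter_subset_right
        (by rw [(hF.2 t ht).2]; omega)
      exact haF (by rwa [← h1, h2])
    rw [Finset.set_biUnion_insert, Finset.sum_insert haF, setIntegral_union₀ hdisj
      (F.measurableSet_biUnion fun t _ => (isCompact_hull t).measurableSet).nullMeasurableSet hf.1
      (integrableOn_finset_iUnion.2 hf.2), ih hF.2 hf.2]

namespace InterfaceMesh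

variable {n : ℕ} (M : InterfaceMesh n)

/-- The difference is covered by the frontiers of finitely many convex cells, which are null. -/
theorem Ω_ae_eq_space (i : Fin 2) : M.Ω i =ᵐ[volume] (M.T i).space := by
  refine interior_subset.eventuallyLE.antisymm ?_
  rw [ae_le_set]
  have hnull : volume (⋃ s ∈ M.cells i, frontier (hull s)) = 0 :=
    (measure_biUnion_null_iff (M.cells i).countable_toSet).2 fun s _ =>
      (convex_convexHull ℝ (s : Set (Pt n))).addHaar_frontier volume
  refine measure_mono_null ?_ hnull
  rintro x ⟨hx, hxΩ⟩
  obtain ⟨s, hs, hxs⟩ := (M.mem_space_iff).1 hx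
  exact Set.mem_iUnion₂.2 ⟨s, hs, subset_closure hxs,
    fun h => hxΩ (interior_mono (M.hull_subset_space hs) h)⟩

theorem setIntegral_Ω {i : Fin 2} {f : Pt n → ℝ}
    (hf : ∀ s ∈ M.cells i, IntegrableOn f (hull s)) :
    ∫ x in M.Ω i, f x = ∑ s ∈ M.cells i, ∫ x in hull s, f x := by
  rw [setIntegral_congr_set (M.Ω_ae_eq_space i), M.space_eq]
  rw [← EuclideanSpace.euclideanHausdorffMeasure_eq_volume] at hf ⊢
  exact setIntegral_biUnion_hull (K := M.T i) (fun s hs => (M.mem_cells).1 hs) hf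

theorem setIntegral_Γ (hn : 2 ≤ n) {f : Pt n → ℝ}
    (hf : ∀ t ∈ M.interfaceFaces, IntegrableOn f (hull t) μHE[n - 1]) :
    ∫ x in M.Γ, f x ∂μHE[n - 1] = ∑ t ∈ M.interfaceFaces, ∫ x in hull t, f x ∂μHE[n - 1] := by
  have hset : M.Γ =ᵐ[μHE[n - 1]] ⋃ t ∈ M.interfaceFaces, hull t := by
    refine Filter.EventuallyLE.antisymm ?_ ?_
    · rw [ae_le_set]
      refine measure_mono_null ?_ M.resolved
      rintro x ⟨hx, hxt⟩
      refine ⟨hx, fun t ht htc hsub hxt' => hxt ?_⟩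
      exact Set.mem_iUnion₂.2 ⟨t, (M.mem_interfaceFaces).2 ⟨ht, htc, hsub⟩, hxt'⟩
    · exact (Set.iUnion₂_subset fun t ht => ((M.mem_interfaceFaces).1 ht).2.2).eventuallyLE
  rw [setIntegral_congr_set hset]
  refine setIntegral_biUnion_hull (K := M.T 0) (fun t ht => ?_) hf
  obtain ⟨h1, h2, -⟩ := (M.mem_interfaceFaces).1 ht
  exact ⟨h1, by omega⟩

theorem integrableOn_norm_sq_gradient {p : ℕ} {i : Fin 2} {v : Pt n → ℝ} (hv : v ∈ M.space p i)
    {s : Finset (Pt n)} (hs : s ∈ M.cells i) :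
    IntegrableOn (fun x => ‖gradient v x‖ ^ 2) (hull s) := by
  obtain ⟨q, -, hq⟩ := hv s hs
  have h : IntegrableOn (fun x => ‖gradFun q x‖ ^ 2) (hull s) :=
    ((continuous_gradFun q).norm.pow 2).continuousOn.integrableOn_compact (isCompact_hull s)
  refine h.congr ?_
  filter_upwards [gradient_ae_eq_gradFun hq] with x hx
  rw [hx]

theorem continuousOn_of_mem_space {p : ℕ} {i : Fin 2} {v : Pt n → ℝ} (hv : v ∈ M.space p i) :
    ContinuousOn v (M.T i).space := by
  have e : (M.T i).space = ⋃ s : M.cells i, hull (s : Finset (Pt n)) := by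
    rw [M.space_eq, Set.iUnion_subtype]
  rw [e]
  refine (locallyFinite_of_finite _).continuousOn_iUnion (fun s => (isCompact_hull _).isClosed) ?_
  rintro ⟨s, hs⟩
  obtain ⟨q, -, hq⟩ := hv s hs
  exact (continuous_evalFun q).continuousOn.congr hq

theorem indep_of_mem_interfaceFaces {t : Finset (Pt n)} (ht : t ∈ M.interfaceFaces) :
    AffineIndependent ℝ ((↑) : t → Pt n) :=
  (M.T 0).indep ((M.mem_interfaceFaces).1 ht).1

/-- The normal derivative of a piecewise polynomial on an interface face is, almost everywhere, the
restriction of a continuous function. -/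
theorem exists_continuous_normalDeriv (hn : 2 ≤ n) {p : ℕ} {v : Pt n → ℝ}
    (hv : v ∈ M.space p 0) {t : Finset (Pt n)} (ht : t ∈ M.interfaceFaces) :
    ∃ D : Pt n → ℝ, Continuous D ∧
      normalDeriv (M.Ω 0) v =ᵐ[(μHE[n - 1]).restrict (hull t)] D := by
  obtain ⟨htf, htc, -⟩ := (M.mem_interfaceFaces).1 ht
  obtain ⟨s, hs, hts⟩ := M.exists_cell htf
  obtain ⟨q, -, hq⟩ := hv s hs
  obtain ⟨ν, hν⟩ := M.exists_outwardNormal_eq ht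
  refine ⟨fun x => inner ℝ (gradFun q x) ν, (continuous_gradFun q).inner continuous_const, ?_⟩
  filter_upwards [ae_mem_relHull (M.indep_of_mem_interfaceFaces ht)
    (show t.card = n - 1 + 1 by omega)] with x hx
  rw [normalDeriv, M.gradientWithin_closure_Ω ht hs hts hq hx, hν x hx]

theorem hE_pos (hn : 2 ≤ n) {t : Finset (Pt n)} (ht : t.card = n) : 0 < hE t := by
  obtain ⟨x, hx, y, hy, hxy⟩ := Finset.one_lt_card.1 (show 1 < t.card by omega)
  exact (dist_pos.2 hxy).trans_le (Metric.dist_le_diam_of_mem (isCompact_hull t).isBounded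
    (subset_convexHull ℝ _ hx) (subset_convexHull ℝ _ hy))

/-! ### The inverse trace inequality -/

/-- The inverse trace inequality on one face of one element. -/
theorem hE_mul_integral_normalDeriv_le (hn : 2 ≤ n) {p : ℕ} {σ : ℝ} (hM : M.ShapeRegular σ)
    {C : ℝ} (hC : 0 ≤ C)
    (hCp : ∀ G : Polynomial ℝ, G.natDegree ≤ p →
      G.eval 0 ^ 2 ≤ C * ∫ s in (0 : ℝ)..(1 / 2), G.eval s ^ 2)
    {v : Pt n → ℝ} (hv : v ∈ M.space p 0) {s t : Finset (Pt n)} (hs : s ∈ M.cells 0)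
    (ht : t ∈ M.interfaceFaces) (hts : t ⊆ s) :
    hE t * ∫ x in hull t, |normalDeriv (M.Ω 0) v x| ^ 2 ∂μHE[n - 1]
      ≤ |σ| * 2 ^ (n - 1) * C * ∫ x in hull s, ‖gradient v x‖ ^ 2 := by
  obtain ⟨x₀, r, hr, hball, hdiam⟩ := hM s hs
  obtain ⟨-, htc, -⟩ := (M.mem_interfaceFaces).1 ht
  obtain ⟨q, hqp, hq⟩ := hv s hs
  have hi := M.indep_of_mem_cells hs
  have hit := M.indep_of_mem_interfaceFaces ht
  have hsub : hull t ⊆ hull s := convexHull_mono (by exact_mod_cast hts)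
  have hcont : Continuous fun x => ‖gradFun q x‖ ^ 2 := (continuous_gradFun q).norm.pow 2
  have hle : ∫ x in hull t, |normalDeriv (M.Ω 0) v x| ^ 2 ∂μHE[n - 1]
      ≤ ∫ x in hull t, ‖gradFun q x‖ ^ 2 ∂μHE[n - 1] := by
    refine integral_mono_of_nonneg (Filter.Eventually.of_forall fun x => sq_nonneg _)
      (integrableOn_hull hit (by omega) hcont.continuousOn) ?_
    filter_upwards [ae_mem_relHull hit (show t.card = n - 1 + 1 by omega)] with x hx
    rw [normalDeriv, M.gradientWithin_closure_Ω ht hs hts hq hx]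
    gcongr
    calc |inner ℝ (gradFun q x) (outwardNormal (M.Ω 0) x)|
        ≤ ‖gradFun q x‖ * ‖outwardNormal (M.Ω 0) x‖ := abs_real_inner_le_norm _ _
      _ ≤ ‖gradFun q x‖ := mul_le_of_le_one_right (norm_nonneg _) (norm_outwardNormal_le _ _)
  have hvol : ∫ x in hull s, ‖gradient v x‖ ^ 2 = ∫ x in hull s, ‖gradFun q x‖ ^ 2 := by
    refine integral_congr_ae ?_
    filter_upwards [gradient_ae_eq_gradFun hq] with x hx
    rw [hx]
  have hh : hE t ≤ |σ| * r :=
    (Metric.diam_mono hsub (isCompact_hull s).isBounded).trans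
      (hdiam.trans (by gcongr; exact le_abs_self σ))
  have htr := simplex_trace_le hi ((M.mem_cells).1 hs).2 hts htc (by omega) hr hball hC hCp q hqp
  have h0 : 0 ≤ ∫ x in hull t, ‖gradFun q x‖ ^ 2 ∂μHE[n - 1] :=
    integral_nonneg fun _ => sq_nonneg _
  have h2 : (2 : ℝ) ^ (n - 1) * (1 / 2) ^ (n - 1) = 1 := by
    rw [← mul_pow]
    norm_num
  rw [hvol]
  calc _ ≤ |σ| * r * ∫ x in hull t, ‖gradFun q x‖ ^ 2 ∂μHE[n - 1] :=
        mul_le_mul hh hle (integral_nonneg fun _ => sq_nonneg _) (by positivity)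
    _ = |σ| * 2 ^ (n - 1) * (r * (1 / 2) ^ (n - 1) *
          ∫ x in hull t, ‖gradFun q x‖ ^ 2 ∂μHE[n - 1]) := by
        linear_combination
          (-|σ| * r * ∫ x in hull t, ‖gradFun q x‖ ^ 2 ∂μHE[n - 1]) * h2
    _ ≤ |σ| * 2 ^ (n - 1) * (C * ∫ x in hull s, ‖gradFun q x‖ ^ 2) :=
        mul_le_mul_of_nonneg_left htr (by positivity)
    _ = _ := by ring

/-- The discrete inverse trace inequality on shape regular meshes. -/
theorem exists_inverseTrace (hn : 2 ≤ n) (p : ℕ) (σ : ℝ) :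
    ∃ C : ℝ, 0 < C ∧ ∀ M : InterfaceMesh n, M.ShapeRegular σ → M.InverseTrace p C := by
  classical
  obtain ⟨C, hC, hCp⟩ := exists_sq_eval_zero_le_integral p
  -- An element has `n + 1` facets, each contributing the one-face constant; the `+ 1` keeps the
  -- constant positive when `σ = 0`.
  refine ⟨(n + 1) * (|σ| * 2 ^ (n - 1) * C) + 1, by positivity, fun M hM v hv s hs => ?_⟩
  set I : ℝ := ∫ x in hull s, ‖gradient v x‖ ^ 2
  have hI : 0 ≤ I := integral_nonneg fun _ => sq_nonneg _
  have hsum := Finset.sum_le_card_nsmul {t ∈ M.interfaceFaces | t ⊆ s}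
    (fun t => hE t * ∫ x in hull t, |normalDeriv (M.Ω 0) v x| ^ 2 ∂μHE[n - 1])
    (|σ| * 2 ^ (n - 1) * C * I) (fun t ht => by
      obtain ⟨h1, h2⟩ := Finset.mem_filter.1 ht
      exact M.hE_mul_integral_normalDeriv_le hn hM hC.le hCp hv hs h1 h2)
  have hcard : ({t ∈ M.interfaceFaces | t ⊆ s} : Finset _).card ≤ n + 1 := by
    have hsub : ({t ∈ M.interfaceFaces | t ⊆ s} : Finset _) ⊆ s.powersetCard n := by
      intro t ht
      obtain ⟨h1, h2⟩ := Finset.mem_filter.1 ht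
      exact Finset.mem_powersetCard.2 ⟨h2, ((M.mem_interfaceFaces).1 h1).2.1⟩
    refine (Finset.card_le_card hsub).trans_eq ?_
    rw [Finset.card_powersetCard, ((M.mem_cells).1 hs).2, Nat.choose_succ_self_right]
  have hcard' : (({t ∈ M.interfaceFaces | t ⊆ s} : Finset _).card : ℝ) ≤ n + 1 := by
    exact_mod_cast hcard
  rw [nsmul_eq_mul] at hsum
  have hnn : 0 ≤ |σ| * 2 ^ (n - 1) * C * I := by positivity
  refine le_trans (le_of_eq ?_) (hsum.trans ?_)
  · congr! 1
  · nlinarith [mul_le_mul_of_nonneg_right hcard' hnn]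

/-- Summing over elements counts every interface face at least once, since each face lies in some
element and the terms are nonnegative. -/
theorem sum_interfaceFaces_le {p : ℕ} {C : ℝ} (hM : M.InverseTrace p C) {v : Pt n → ℝ}
    (hv : v ∈ M.space p 0) :
    ∑ t ∈ M.interfaceFaces, hE t * ∫ x in hull t, |normalDeriv (M.Ω 0) v x| ^ 2 ∂μHE[n - 1]
      ≤ C * ∫ x in M.Ω 0, ‖gradient v x‖ ^ 2 := by
  classical
  rw [M.setIntegral_Ω fun s hs => M.integrableOn_norm_sq_gradient hv hs, Finset.mul_sum]
  refine le_trans ?_ (Finset.sum_le_sum fun s hs => hM v hv s hs)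
  simp only [Finset.sum_filter]
  rw [Finset.sum_comm]
  refine Finset.sum_le_sum fun t ht => ?_
  obtain ⟨s, hs, hts⟩ := M.exists_cell ((M.mem_interfaceFaces).1 ht).1
  have hnn : 0 ≤ hE t * ∫ x in hull t, |normalDeriv (M.Ω 0) v x| ^ 2 ∂μHE[n - 1] :=
    mul_nonneg Metric.diam_nonneg (integral_nonneg fun _ => sq_nonneg _)
  refine le_trans (le_of_eq (if_pos hts).symm) (Finset.single_le_sum (f := fun s => if t ⊆ s then
    hE t * ∫ x in hull t, |normalDeriv (M.Ω 0) v x| ^ 2 ∂μHE[n - 1] else 0) (fun s _ => ?_) hs)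
  split_ifs
  · exact hnn
  · exact le_rfl

/-! ### Coercivity -/

/-- Integrability of the penalty term on a face. -/
theorem integrableOn_penalty (hn : 2 ≤ n) {γ : ℝ} {ε : Pt n → ℝ} (hε : M.IsNitscheParameter γ ε)
    {t : Finset (Pt n)} (ht : t ∈ M.interfaceFaces) {a b : Pt n → ℝ}
    (ha : ContinuousOn a (hull t)) (hb : ContinuousOn b (hull t)) :
    IntegrableOn (fun x => 1 / ε x * a x * b x) (hull t) μHE[n - 1] := by
  have h := integrableOn_hull (M.indep_of_mem_interfaceFaces ht)
    (show t.card = n - 1 + 1 by have := ((M.mem_interfaceFaces).1 ht).2.1; omega)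
    ((continuousOn_const (c := 1 / (hE t / (2 * γ)))).mul ha |>.mul hb)
  refine h.congr ?_
  filter_upwards [hε t ht] with x hx
  rw [hx]
  rfl

/-- Young's inequality for the consistency term on a face. -/
theorem two_mul_integral_normalDeriv_le (hn : 2 ≤ n) {p : ℕ} {γ : ℝ} (hγ : 0 < γ)
    {v : Pt n → ℝ} (hv : v ∈ M.space p 0) {t : Finset (Pt n)} (ht : t ∈ M.interfaceFaces)
    {w : Pt n → ℝ} (hw : ContinuousOn w (hull t)) :
    IntegrableOn (fun x => normalDeriv (M.Ω 0) v x * w x) (hull t) μHE[n - 1] ∧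
    2 * ∫ x in hull t, normalDeriv (M.Ω 0) v x * w x ∂μHE[n - 1]
      ≤ 1 / γ * (hE t * ∫ x in hull t, |normalDeriv (M.Ω 0) v x| ^ 2 ∂μHE[n - 1])
        + γ * ∫ x in hull t, 1 / hE t * w x ^ 2 ∂μHE[n - 1] := by
  obtain ⟨-, htc, -⟩ := (M.mem_interfaceFaces).1 ht
  have hh := hE_pos hn htc
  have hit := M.indep_of_mem_interfaceFaces ht
  have hc1 : t.card = n - 1 + 1 := by omega
  obtain ⟨D, hD, hae⟩ := M.exists_continuous_normalDeriv hn hv ht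
  have i1 : IntegrableOn (fun x => normalDeriv (M.Ω 0) v x * w x) (hull t) μHE[n - 1] := by
    refine (integrableOn_hull hit hc1 (hD.continuousOn.mul hw)).congr ?_
    filter_upwards [hae] with x hx
    rw [hx]
    rfl
  have i2 : IntegrableOn (fun x => |normalDeriv (M.Ω 0) v x| ^ 2) (hull t) μHE[n - 1] := by
    refine (integrableOn_hull hit hc1 ((hD.abs.pow 2).continuousOn)).congr ?_
    filter_upwards [hae] with x hx
    rw [hx]
    rfl
  have i3 : IntegrableOn (fun x => 1 / hE t * w x ^ 2) (hull t) μHE[n - 1] :=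
    integrableOn_hull hit hc1 (continuousOn_const.mul (hw.pow 2))
  refine ⟨i1, ?_⟩
  rw [← mul_assoc, ← integral_const_mul, ← integral_const_mul, ← integral_const_mul,
    ← integral_add (i2.const_mul _) (i3.const_mul _)]
  refine integral_mono (i1.const_mul _) ((i2.const_mul _).add (i3.const_mul _)) fun x => ?_
  simp only [sq_abs]
  set a := normalDeriv (M.Ω 0) v x
  have key : 1 / γ * hE t * a ^ 2 + γ * (1 / hE t * w x ^ 2) - 2 * (a * w x)
      = (hE t * a - γ * w x) ^ 2 / (γ * hE t) := by
    field_simp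
    ring
  have hpos : 0 ≤ (hE t * a - γ * w x) ^ 2 / (γ * hE t) := by positivity
  linarith

/-- Coercivity of the one-sided Nitsche form, given the discrete inverse trace inequality. -/
theorem energy_le_B (hn : 2 ≤ n) {p : ℕ} {C γ : ℝ} (hC : 0 < C) (hγ : C < γ)
    (hM : M.InverseTrace p C) {ε : Pt n → ℝ} (hε : M.IsNitscheParameter γ ε)
    {v : Fin 2 → Pt n → ℝ} (hv : ∀ i, v i ∈ M.space p i) :
    min (1 - C / γ) γ * M.energy v ≤ M.B ε v v := by
  have hγ0 : 0 < γ := hC.trans hγ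
  have hsub : ∀ t ∈ M.interfaceFaces, ∀ i, ContinuousOn (v i) (hull t) := fun t ht i =>
    (M.continuousOn_of_mem_space (hv i)).mono
      ((((M.mem_interfaceFaces).1 ht).2.2).trans (M.Γ_subset_space i))
  have hw : ∀ t ∈ M.interfaceFaces, ContinuousOn (fun x => v 0 x - v 1 x) (hull t) :=
    fun t ht => (hsub t ht 0).sub (hsub t ht 1)
  have hw' : ∀ t ∈ M.interfaceFaces, ContinuousOn (fun x => v 1 x - v 0 x) (hull t) :=
    fun t ht => (hsub t ht 1).sub (hsub t ht 0)
  have hp0 := fun t ht => M.integrableOn_penalty hn hε ht (hw t ht) (hsub t ht 0)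
  have hp1 := fun t ht => M.integrableOn_penalty hn hε ht (hw' t ht) (hsub t ht 1)
  have hyoung := fun t ht => M.two_mul_integral_normalDeriv_le hn hγ0 (hv 0) ht (hw t ht)
  -- The test functions combine into the squared jump, and `1 / ε = 2γ / h_E`; Young's inequality
  -- uses up only half of this `2γ`.
  have hpen : ∀ t ∈ M.interfaceFaces,
      (∫ x in hull t, 1 / ε x * (v 0 x - v 1 x) * v 0 x ∂μHE[n - 1])
        + (∫ x in hull t, 1 / ε x * (v 1 x - v 0 x) * v 1 x ∂μHE[n - 1])
      = 2 * γ * ∫ x in hull t, 1 / hE t * (v 0 x - v 1 x) ^ 2 ∂μHE[n - 1] := by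
    intro t ht
    rw [← integral_add (hp0 t ht) (hp1 t ht), ← integral_const_mul]
    refine integral_congr_ae ?_
    filter_upwards [hε t ht] with x hx
    rw [hx, one_div_div]
    ring
  have hB : M.B ε v v = (∫ x in M.Ω 0, ‖gradient (v 0) x‖ ^ 2)
      + (∫ x in M.Ω 1, ‖gradient (v 1) x‖ ^ 2)
      + ∑ t ∈ M.interfaceFaces, (2 * γ * (∫ x in hull t, 1 / hE t * (v 0 x - v 1 x) ^ 2 ∂μHE[n - 1])
        - 2 * ∫ x in hull t, normalDeriv (M.Ω 0) (v 0) x * (v 0 x - v 1 x) ∂μHE[n - 1]) := by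
    have hr0 : (0 : Fin 2).rev = 1 := rfl
    have hr1 : (1 : Fin 2).rev = 0 := rfl
    rw [B, Fin.sum_univ_two, hr0, hr1, M.setIntegral_Γ hn hp0, M.setIntegral_Γ hn hp1,
      M.setIntegral_Γ hn fun t ht => (hyoung t ht).1, Finset.sum_sub_distrib,
      ← Finset.sum_congr rfl hpen, Finset.sum_add_distrib, ← Finset.mul_sum]
    simp only [real_inner_self_eq_norm_sq]
    ring
  have hfaces := Finset.sum_le_sum fun t ht => (hyoung t ht).2
  rw [Finset.sum_add_distrib, ← Finset.mul_sum, ← Finset.mul_sum, ← Finset.mul_sum] at hfaces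
  have htrace := mul_le_mul_of_nonneg_left (M.sum_interfaceFaces_le hM (hv 0))
    (show 0 ≤ 1 / γ by positivity)
  rw [hB, energy, Fin.sum_univ_two, Finset.sum_sub_distrib, ← Finset.mul_sum, ← Finset.mul_sum]
  set G₀ : ℝ := ∫ x in M.Ω 0, ‖gradient (v 0) x‖ ^ 2
  set G₁ : ℝ := ∫ x in M.Ω 1, ‖gradient (v 1) x‖ ^ 2
  set J : ℝ := ∑ t ∈ M.interfaceFaces, ∫ x in hull t, 1 / hE t * (v 0 x - v 1 x) ^ 2 ∂μHE[n - 1]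
  have hG₀ : 0 ≤ G₀ := integral_nonneg fun _ => sq_nonneg _
  have hG₁ : 0 ≤ G₁ := integral_nonneg fun _ => sq_nonneg _
  have hJ : 0 ≤ J := Finset.sum_nonneg fun t _ => integral_nonneg fun x =>
    mul_nonneg (one_div_nonneg.2 Metric.diam_nonneg) (sq_nonneg _)
  have hc1 : min (1 - C / γ) γ ≤ 1 - C / γ := min_le_left _ _
  have hc2 : min (1 - C / γ) γ ≤ γ := min_le_right _ _
  have hCγ : 0 < C / γ := by positivity
  have e : 1 / γ * (C * G₀) = C / γ * G₀ := by ring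
  rw [e] at htrace
  have m0 := mul_le_mul_of_nonneg_right hc1 hG₀
  have m1 := mul_le_mul_of_nonneg_right (hc1.trans (by linarith : 1 - C / γ ≤ 1)) hG₁
  have m2 := mul_le_mul_of_nonneg_right hc2 hJ
  linarith

end InterfaceMesh

end Nitsche

theorem mainTheorem1 (n : ℕ) (hn : 2 ≤ n) (p : ℕ) :
    (∀ σ : ℝ, ∃ C_I : ℝ, 0 < C_I ∧
      (∀ M : Nitsche.InterfaceMesh n, M.ShapeRegular σ → M.InverseTrace p C_I) ∧
      (∀ γ : ℝ, C_I < γ → ∃ c : ℝ, 0 < c ∧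
        ∀ M : Nitsche.InterfaceMesh n, M.ShapeRegular σ →
          ∀ ε : Nitsche.Pt n → ℝ, M.IsNitscheParameter γ ε →
            ∀ v : Fin 2 → Nitsche.Pt n → ℝ, (∀ i, v i ∈ M.space p i) →
              c * M.energy v ≤ M.B ε v v)) ∧
    (∀ C_I γ : ℝ, 0 < C_I → C_I < γ → ∃ c : ℝ, 0 < c ∧
      ∀ M : Nitsche.InterfaceMesh n, M.InverseTrace p C_I →
        ∀ ε : Nitsche.Pt n → ℝ, M.IsNitscheParameter γ ε →
          ∀ v : Fin 2 → Nitsche.Pt n → ℝ, (∀ i, v i ∈ M.space p i) →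
            c * M.energy v ≤ M.B ε v v) := by
  have hpos : ∀ C γ : ℝ, 0 < C → C < γ → 0 < min (1 - C / γ) γ := fun C γ hC hγ =>
    lt_min (sub_pos.2 ((div_lt_one (hC.trans hγ)).2 hγ)) (hC.trans hγ)
  refine ⟨fun σ => ?_, fun C γ hC hγ => ⟨_, hpos C γ hC hγ, fun M hM ε hε v hv =>
    M.energy_le_B hn hC hγ hM hε hv⟩⟩
  obtain ⟨C, hC, hCM⟩ := Nitsche.InterfaceMesh.exists_inverseTrace hn p σ
  exact ⟨C, hC, hCM, fun γ hγ => ⟨_, hpos C γ hC hγ, fun M hM ε hε v hv =>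
    M.energy_le_B hn hC hγ (hCM M hM) hε hv⟩⟩
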